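/- Let $d\ge 0$ be an integer. A point $p\in\mathbb{R}^d$ is said to be encapsulated by sets $K_1,K_2,K_3\subseteq\mathbb{R}^d$ if there is an $\varepsilon>0$ such that $B(p,\varepsilon)\setminus(K_1\cup K_2\cup K_3)=\{p\}$, where $B(p,\varepsilon)$ is the open Euclidean ball of radius $\varepsilon$ centred at $p$; that is, $p$ lies in none of the sets, but they cover a punctured neighbourhood of $p$. For sets $K_1,K_2,K_3$ let $S$ be the set of all points encapsulated by them, and put $f(d)=\lfloor 3d/2\rfloor+1$. Then: (a) for all convex sets $K_1,K_2,K_3\subseteq\mathbb{R}^d$ (possibly empty), the set $S$ is finite and $|S|\le f(d)$; (b) for all convex sets $K_1,K_2,K_3\subseteq\mathbb{R}^d$, if $|S|=f(d)$ then $K_1,K_2,K_3$ are pairwise disjoint; (c) there exist convex sets $K_1,K_2,K_3\subseteq\mathbb{R}^d$ such that $|S|=f(d)$ and $\mathbb{R}^d\setminus(K_1\cup K_2\cup K_3)=S$. -/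

import Mathlib

/-- The point `p` of `ℝ^d` is encapsulated by the family of sets `K`: for some `ε > 0`, the point
`p` is the only point of the open Euclidean ball `B(p, ε)` not covered by the sets `K i`.
In particular `p` itself lies in none of the sets. -/
def IsEncapsulated {d : ℕ} {ι : Type*} (K : ι → Set (EuclideanSpace ℝ (Fin d)))
    (p : EuclideanSpace ℝ (Fin d)) : Prop :=
  ∃ ε : ℝ, 0 < ε ∧ Metric.ball p ε \ (⋃ i, K i) = {p}

/-- The set of all points of `ℝ^d` encapsulated by the family `K`. -/
def encapsulatedPoints {d : ℕ} {ι : Type*} (K : ι → Set (EuclideanSpace ℝ (Fin d))) :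
    Set (EuclideanSpace ℝ (Fin d)) :=
  {p | IsEncapsulated K p}

open Set Filter Topology

/-! Everything rests on f(d) = f(d - 2) + 3. Two convex sets alone can encapsulate at most one
point, and then they are disjoint (`eq_of_union_mem_nhdsNE`, `disjoint_of_union_mem_nhdsNE`). Hence
for each `k` at most one encapsulated point has `K k` absent nearby.

Upper bound: at an encapsulated p choose normals uᵢ with Kᵢ in the half-space ⟨uᵢ, x⟩ ≤ ⟨uᵢ, p⟩.
Since the sets cover every direction at p, 0 lies in the convex hull of the uᵢ. If all coefficients
are positive and u₀, u₁ are independent, any other encapsulated point is strictly outside some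
half-space, hence one of three exceptional points, or lies on a flat of codimension two, which
carries at most f(d - 2) by induction. Otherwise a hyperplane separates two of the sets: all points
lie on it, or a point off it yields a second hyperplane and either the same count or at most two
points. In case of equality the exceptional points that must exist force disjointness.

Lower bound: from an example in E, divide E × ℝ² into three sectors along three half-spaces with
common boundary E. Semispaces split each half-space between its two neighbouring sectors, losing
exactly one point (`exists_halfspace_split`). -/

/-! ### Semispaces and the splitting of a half-space -/

/-- A convex set avoiding the origin extends to a convex set avoiding the origin which contains
one of `x`, `-x` for every `x ≠ 0`. -/
theorem exists_semispace {V : Type*} [AddCommGroup V] [Module ℝ V] {M : Set V}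
    (hM : Convex ℝ M) (h0 : (0 : V) ∉ M) :
    ∃ C, M ⊆ C ∧ Convex ℝ C ∧ (0 : V) ∉ C ∧ ∀ x, x ≠ 0 → x ∈ C ∨ -x ∈ C := by
  obtain ⟨C, hMC, hC⟩ := zorn_subset_nonempty {C : Set V | Convex ℝ C ∧ (0 : V) ∉ C}
    (fun c hc hchain _ => ⟨⋃₀ c, ⟨hchain.directedOn.convex_sUnion fun _ hA => (hc hA).1,
      fun ⟨A, hA, h⟩ => (hc hA).2 h⟩, fun _ hs => subset_sUnion_of_mem hs⟩) M ⟨hM, h0⟩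
  obtain ⟨hconv, h0C⟩ := hC.prop
  refine ⟨C, hMC, hconv, h0C, fun x hx => ?_⟩
  -- Maximality makes `C` a cone: its positive multiples form a convex set still missing the origin.
  have hcone : ∀ t : ℝ, 0 < t → ∀ c ∈ C, t • c ∈ C := by
    intro t ht c hc
    have hcv : Convex ℝ {y | ∃ s : ℝ, 0 < s ∧ ∃ c ∈ C, y = s • c} := by
      rw [convex_iff_forall_pos]
      rintro _ ⟨s, hs, c, hc, rfl⟩ _ ⟨s', hs', c', hc', rfl⟩ a b ha hb hab
      have hpos : 0 < a * s + b * s' := by positivity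
      refine ⟨a * s + b * s', hpos, _, hconv hc hc'
        (a := a * s / (a * s + b * s')) (b := b * s' / (a * s + b * s'))
        (by positivity) (by positivity) (by field_simp), ?_⟩
      rw [smul_add, smul_smul, smul_smul, smul_smul, smul_smul]
      congr 2 <;> field_simp
    refine hC.le_of_ge (y := {y | ∃ s : ℝ, 0 < s ∧ ∃ c ∈ C, y = s • c}) ⟨hcv, ?_⟩
      (fun c hc => ⟨1, one_pos, c, hc, (one_smul _ _).symm⟩) ⟨t, ht, c, hc, rfl⟩
    rintro ⟨s, hs, c, hc, h⟩
    rcases smul_eq_zero.1 h.symm with h | h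
    · exact hs.ne' h
    · exact h0C (h ▸ hc)
  by_contra! hcon
  rcases C.eq_empty_or_nonempty with rfl | hne
  · exact (hC.le_of_ge (y := {x}) ⟨convex_singleton _, fun h => hx h.symm⟩ (empty_subset _)) rfl
  -- If adding `x` captures the origin, `-x` is a positive multiple of a point of `C`; if not,
  -- maximality puts `x` in `C`.
  by_cases h0 : (0 : V) ∈ convexHull ℝ (insert x C)
  · rw [convexHull_insert hne, hconv.convexHull_eq, mem_convexJoin] at h0
    obtain ⟨y, rfl, c, hc, a, b, ha, hb, hab, h⟩ := h0
    rcases ha.eq_or_lt with rfl | ha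
    · obtain rfl : b = 1 := by linarith
      exact h0C (by simpa using (show (0 : V) = c by simpa using h.symm) ▸ hc)
    rcases hb.eq_or_lt with rfl | hb
    · obtain rfl : a = 1 := by linarith
      exact hx (by simpa using h)
    · refine hcon.2 ?_
      have : -y = (a⁻¹ * b) • c := by
        rw [neg_eq_iff_add_eq_zero, mul_smul]
        have := congrArg (a⁻¹ • ·) h
        simpa [smul_add, smul_smul, ha.ne'] using this
      rw [this]
      exact hcone _ (by positivity) _ hc
  · exact hcon.1 (hC.le_of_ge ⟨convex_convexHull ℝ _, h0⟩
      ((subset_insert _ _).trans (subset_convexHull ℝ _)) (subset_convexHull ℝ _ (mem_insert _ _)))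

/-- The open upper half space together with a convex subset of its boundary is convex. -/
theorem convex_upper_union {E : Type*} [AddCommGroup E] [Module ℝ E] {A : Set E}
    (hA : Convex ℝ A) : Convex ℝ {w : E × ℝ | 0 ≤ w.2 ∧ (w.2 = 0 → w.1 ∈ A)} := by
  rw [convex_iff_forall_pos]
  rintro ⟨x, h⟩ ⟨hx0, hx⟩ ⟨y, k⟩ ⟨hy0, hy⟩ a b ha hb hab
  simp only at hx0 hx hy0 hy
  refine ⟨by simp; positivity, fun h0 => ?_⟩
  simp only [Prod.smul_mk, Prod.mk_add_mk, smul_eq_mul] at h0 ⊢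
  have h1 : 0 ≤ a * h := by positivity
  have h2 : 0 ≤ b * k := by positivity
  have h3 : a * h = 0 := by linarith
  have h4 : b * k = 0 := by linarith
  exact hA (hx (by simpa [ha.ne'] using h3)) (hy (by simpa [hb.ne'] using h4)) ha.le hb.le hab

/-- Two disjoint convex sets in the boundary of a half space extend to disjoint convex sets that
cover all but one point of the open half space. -/
theorem exists_halfspace_split {E : Type*} [AddCommGroup E] [Module ℝ E] {A B : Set E}
    (hA : Convex ℝ A) (hB : Convex ℝ B) (hAB : Disjoint A B) :
    ∃ A' B' : Set (E × ℝ), Convex ℝ A' ∧ Convex ℝ B' ∧ Disjoint A' B' ∧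
      (∀ x, (x, (0 : ℝ)) ∈ A' ↔ x ∈ A) ∧ (∀ x, (x, (0 : ℝ)) ∈ B' ↔ x ∈ B) ∧
      ∀ x h, 0 < h → ((x, h) ∈ A' ∨ (x, h) ∈ B' ↔ (x, h) ≠ ((0 : E), (1 : ℝ))) := by
  have hP : Convex ℝ ((fun a : E => (a, (-1 : ℝ))) '' A) := by
    have : (fun a : E => (a, (-1 : ℝ))) '' A = A ×ˢ {-1} := by ext ⟨x, y⟩; simp [eq_comm]
    rw [this]; exact hA.prod (convex_singleton _)
  have hQ : Convex ℝ ((fun a : E => (-a, (1 : ℝ))) '' B) := by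
    have : (fun a : E => (-a, (1 : ℝ))) '' B = (-B) ×ˢ {1} := by
      ext ⟨x, y⟩
      simp only [mem_image, Prod.mk.injEq, mem_prod, Set.mem_neg, mem_singleton_iff]
      constructor
      · rintro ⟨b, hb, rfl, rfl⟩; simpa using hb
      · rintro ⟨hb, rfl⟩; exact ⟨-x, hb, by simp⟩
    rw [this]; exact hB.neg.prod (convex_singleton _)
  -- Viewed from `(0, 1)`, points of `A` should lie in the semispace and points of `B` in its
  -- negative. The last coordinates ∓1 force equal weights, so a vanishing combination would give a
  -- common point of `A` and `B`.
  have h0 : (0 : E × ℝ) ∉ convexHull ℝ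
      ((fun a : E => (a, (-1 : ℝ))) '' A ∪ (fun a : E => (-a, (1 : ℝ))) '' B) := by
    rcases A.eq_empty_or_nonempty with rfl | hAn
    · rw [image_empty, empty_union, hQ.convexHull_eq]
      rintro ⟨b, -, h⟩
      simp [Prod.ext_iff] at h
    rcases B.eq_empty_or_nonempty with rfl | hBn
    · rw [image_empty, union_empty, hP.convexHull_eq]
      rintro ⟨b, -, h⟩
      simp [Prod.ext_iff] at h
    rw [hP.convexHull_union hQ (hAn.image _) (hBn.image _), mem_convexJoin]
    rintro ⟨_, ⟨x, hx, rfl⟩, _, ⟨y, hy, rfl⟩, a, b, ha, hb, hab, h⟩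
    simp only [Prod.smul_mk, Prod.mk_add_mk, Prod.mk_eq_zero, smul_eq_mul] at h
    obtain ⟨h1, h2⟩ := h
    obtain rfl : a = b := by linarith
    have ha' : a ≠ 0 := by intro h; simp [h] at hab
    rw [← smul_add, smul_eq_zero_iff_right ha', add_neg_eq_zero] at h1
    exact disjoint_left.1 hAB hx (h1 ▸ hy)
  obtain ⟨C, hMC, hC, h0C, htot⟩ := exists_semispace (convex_convexHull ℝ _) h0
  replace hMC := (subset_convexHull ℝ _).trans hMC
  have hz : Convex ℝ {w : E × ℝ | w - (0, 1) ∈ C} := by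
    simp_rw [sub_eq_add_neg]
    exact hC.translate_preimage_left (-(0, 1))
  have hz' : Convex ℝ {w : E × ℝ | -(w - (0, 1)) ∈ C} := by
    simp_rw [sub_eq_add_neg]
    exact hC.neg.translate_preimage_left (-(0, 1))
  refine ⟨_, _, hz.inter (convex_upper_union hA), hz'.inter (convex_upper_union hB), ?_, ?_, ?_, ?_⟩
  · rw [disjoint_left]
    rintro w ⟨hw, -⟩ ⟨hw', -⟩
    have := hC hw hw' (a := 1 / 2) (b := 1 / 2) (by norm_num) (by norm_num) (by norm_num)
    rw [smul_neg, add_neg_cancel] at this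
    exact h0C this
  · intro x
    constructor
    · rintro ⟨-, -, h⟩; exact h rfl
    · intro hx
      exact ⟨by simpa using hMC (Or.inl ⟨x, hx, rfl⟩), le_rfl, fun _ => hx⟩
  · intro x
    constructor
    · rintro ⟨-, -, h⟩; exact h rfl
    · intro hx
      exact ⟨by simpa using hMC (Or.inr ⟨x, hx, rfl⟩), le_rfl, fun _ => hx⟩
  · intro x h hh
    constructor
    · rintro (⟨hw, -⟩ | ⟨hw, -⟩) heq <;> rw [mem_ofPred_eq, heq] at hw <;> simp [h0C] at hw
    · intro hne
      have hup : ∀ A : Set E, (x, h) ∈ {w : E × ℝ | 0 ≤ w.2 ∧ (w.2 = 0 → w.1 ∈ A)} :=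
        fun A => ⟨hh.le, fun h => absurd h hh.ne'⟩
      exact (htot _ (sub_ne_zero.2 hne)).imp (fun h => ⟨h, hup _⟩) (fun h => ⟨h, hup _⟩)

/-! ### Construction of extremal triples -/

/-- `V` is covered, up to exactly `n` points, by three pairwise disjoint convex sets. -/
def HasTriplePartition (V : Type*) [AddCommGroup V] [Module ℝ V] (n : ℕ) : Prop :=
  ∃ A B C : Set V, Convex ℝ A ∧ Convex ℝ B ∧ Convex ℝ C ∧
    Disjoint A B ∧ Disjoint A C ∧ Disjoint B C ∧ (A ∪ B ∪ C)ᶜ.encard = n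

theorem HasTriplePartition.congr {V W : Type*} [AddCommGroup V] [Module ℝ V] [AddCommGroup W]
    [Module ℝ W] {n : ℕ} (h : HasTriplePartition V n) (e : W ≃ₗ[ℝ] V) :
    HasTriplePartition W n := by
  obtain ⟨A, B, C, hA, hB, hC, hAB, hAC, hBC, hn⟩ := h
  refine ⟨e ⁻¹' A, e ⁻¹' B, e ⁻¹' C, hA.linear_preimage e.toLinearMap,
    hB.linear_preimage e.toLinearMap, hC.linear_preimage e.toLinearMap, hAB.preimage _,
    hAC.preimage _, hBC.preimage _, ?_⟩
  rw [← preimage_union, ← preimage_union, ← preimage_compl, ← hn]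
  exact encard_preimage_of_bijective e.bijective _

theorem convex_setOf_le_and_imp {W X : Type*} [AddCommGroup W] [Module ℝ W] [AddCommGroup X]
    [Module ℝ X] (l : W →ₗ[ℝ] ℝ) (g : W →ₗ[ℝ] X) {A : Set X} (hA : Convex ℝ A) :
    Convex ℝ {w | 0 ≤ l w ∧ (l w = 0 → g w ∈ A)} := by
  have := (convex_upper_union hA).linear_preimage (g.prod l)
  simpa using this

/-- In the `(s, t)` plane the rays `s = t ≥ 0`, `s = 0 ≥ t` and `t = 0 ≥ s` bound three convex
sectors, one per set. Over each ray lies a half-space bounded by `E`, split compatibly with the old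
sets and losing one point. -/
theorem HasTriplePartition.prod {E : Type*} [AddCommGroup E] [Module ℝ E] {n : ℕ}
    (h : HasTriplePartition E n) : HasTriplePartition (E × ℝ × ℝ) (n + 3) := by
  obtain ⟨A, B, C, hA, hB, hC, hAB, hAC, hBC, hn⟩ := h
  obtain ⟨Ab, Ba, hAb, hBa, dAB, hAb0, hBa0, hABz⟩ := exists_halfspace_split hA hB hAB
  obtain ⟨Ac, Ca, hAc, hCa, dAC, hAc0, hCa0, hACz⟩ := exists_halfspace_split hA hC hAC
  obtain ⟨Bc, Cb, hBc, hCb, dBC, hBc0, hCb0, hBCz⟩ := exists_halfspace_split hB hC hBC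
  let x : E × ℝ × ℝ →ₗ[ℝ] E := LinearMap.fst ℝ _ _
  let s : E × ℝ × ℝ →ₗ[ℝ] ℝ := LinearMap.fst ℝ _ _ ∘ₗ LinearMap.snd ℝ _ _
  let t : E × ℝ × ℝ →ₗ[ℝ] ℝ := LinearMap.snd ℝ _ _ ∘ₗ LinearMap.snd ℝ _ _
  refine ⟨_, _, _,
    (convex_setOf_le_and_imp (s - t) (x.prod s) hAb).inter
      (convex_setOf_le_and_imp s (x.prod (-t)) hAc),
    (convex_setOf_le_and_imp (t - s) (x.prod s) hBa).inter
      (convex_setOf_le_and_imp t (x.prod (-s)) hBc),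
    (convex_setOf_le_and_imp (-s) (x.prod (-t)) hCa).inter
      (convex_setOf_le_and_imp (-t) (x.prod (-s)) hCb), ?_, ?_, ?_, ?_⟩
  · rw [disjoint_left]
    rintro ⟨p, a, b⟩ ⟨⟨h1, h2⟩, -⟩ ⟨⟨h3, h4⟩, -⟩
    simp [x, s, t] at h1 h2 h3 h4
    exact disjoint_left.1 dAB (h2 (by linarith)) (h4 (by linarith))
  · rw [disjoint_left]
    rintro ⟨p, a, b⟩ ⟨-, h1, h2⟩ ⟨⟨h3, h4⟩, -⟩
    simp [x, s, t] at h1 h2 h3 h4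
    exact disjoint_left.1 dAC (h2 (by linarith)) (h4 (by linarith))
  · rw [disjoint_left]
    rintro ⟨p, a, b⟩ ⟨-, h1, h2⟩ ⟨-, h3, h4⟩
    simp [x, s, t] at h1 h2 h3 h4
    exact disjoint_left.1 dBC (h2 (by linarith)) (h4 (by linarith))
  · have key : ∀ T : Set (E × ℝ × ℝ), T = insert (0, 1, 1) (insert (0, 0, -1) (insert (0, -1, 0)
        ((fun y : E => (y, (0 : ℝ), (0 : ℝ))) '' (A ∪ B ∪ C)ᶜ))) → T.encard = (n + 3 : ℕ) := by
      rintro _ rfl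
      rw [encard_insert_of_notMem (by simp [Prod.ext_iff]),
        encard_insert_of_notMem (by simp [Prod.ext_iff]),
        encard_insert_of_notMem (by simp [Prod.ext_iff]),
        Function.Injective.encard_image (fun a b h => by simpa using h), hn]
      norm_cast
    apply key
    ext ⟨p, a, b⟩
    have e1 := hABz p a
    have e2 := hACz p (-b)
    have e3 := hBCz p (-a)
    have z1 := hAb0 p
    have z2 := hBa0 p
    have z3 := hAc0 p
    have z4 := hCa0 p
    have z5 := hBc0 p
    have z6 := hCb0 p
    simp only [x, s, t, mem_compl_iff, mem_union, mem_inter_iff, mem_ofPred_eq, LinearMap.sub_apply,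
      LinearMap.comp_apply, LinearMap.fst_apply, LinearMap.snd_apply, LinearMap.prod_apply,
      LinearMap.neg_apply, mem_insert_iff, Prod.mk.injEq, mem_image, ne_eq] at e1 e2 e3 ⊢
    have hr : (∃ y, ¬((y ∈ A ∨ y ∈ B) ∨ y ∈ C) ∧ y = p ∧ 0 = a ∧ 0 = b) ↔
        (¬((p ∈ A ∨ p ∈ B) ∨ p ∈ C) ∧ 0 = a ∧ 0 = b) :=
      ⟨fun ⟨y, h, e, h'⟩ => e ▸ ⟨h, h'⟩, fun ⟨h, h'⟩ => ⟨p, h, rfl, h'⟩⟩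
    rw [hr]
    change ¬(((0 ≤ a - b ∧ (a - b = 0 → (p, a) ∈ Ab)) ∧ 0 ≤ a ∧ (a = 0 → (p, -b) ∈ Ac) ∨
      (0 ≤ b - a ∧ (b - a = 0 → (p, a) ∈ Ba)) ∧ 0 ≤ b ∧ (b = 0 → (p, -a) ∈ Bc)) ∨
      (0 ≤ -a ∧ (-a = 0 → (p, -b) ∈ Ca)) ∧ 0 ≤ -b ∧ (-b = 0 → (p, -a) ∈ Cb)) ↔ _
    clear * - e1 e2 e3 z1 z2 z3 z4 z5 z6
    -- The signs locate `(a, b)` among sectors and rays; only the open positive quadrant is crossed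
    -- by a ray and must be split again.
    rcases lt_trichotomy a 0 with ha | rfl | ha <;> rcases lt_trichotomy b 0 with hb | rfl | hb
    · simp [ha.not_ge, hb.not_ge, ha.le, hb.le, ha.ne, hb.ne, ha.ne', hb.ne',
        (ha.trans one_pos).ne]
    · simp [ha.not_ge, ha.le, ha.ne, ha.ne'] at e3 ⊢
      grind
    · simp [hb.not_ge, ha.le, hb.le, ha.ne, hb.ne, ha.ne', hb.ne',
        (ha.trans one_pos).ne, (ha.trans hb).le]
      grind
    · simp [hb.not_ge, hb.le, hb.ne, hb.ne'] at e2 ⊢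
      grind
    · simp [z1, z2, z3, z4, z5, z6]
    · simp [hb.not_ge, hb.le, hb.ne, hb.ne']
      grind
    · simp [ha.not_ge, hb.not_ge, ha.le, hb.le, ha.ne, hb.ne, ha.ne', hb.ne', sub_eq_zero,
        (hb.trans ha).ne', (hb.trans ha).le]
      grind
    · simp [ha.not_ge, ha.le, ha.ne, ha.ne']
      grind
    · rcases lt_trichotomy a b with hab | rfl | hab
      · simp [ha.not_ge, hb.not_ge, ha.le, hb.le, ha.ne, hb.ne, ha.ne', hb.ne', sub_eq_zero, hab.le,
          hab.ne, hab.ne', hab.not_ge]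
        grind
      · simp [ha, ha.not_ge, ha.le, ha.ne, ha.ne'] at e1 ⊢
        grind
      · simp [ha.not_ge, hb.not_ge, ha.le, hb.le, ha.ne, hb.ne, ha.ne', hb.ne', sub_eq_zero, hab.le,
          hab.ne, hab.ne', hab.not_ge]
        grind

/-- Induction in steps of two: 3(d + 2)/2 = 3d/2 + 3 even with rounding, so dimensions 0 and 1 both
serve as bases. -/
theorem hasTriplePartition_of_finrank (d : ℕ) : ∀ (V : Type) [AddCommGroup V] [Module ℝ V]
    [FiniteDimensional ℝ V], Module.finrank ℝ V = d → HasTriplePartition V (3 * d / 2 + 1) := by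
  induction d using Nat.strong_induction_on with
  | _ d ih =>
    intro V _ _ _ hV
    match d, ih, hV with
    | 0, _, hV =>
      have := Module.finrank_zero_iff.1 hV
      refine ⟨∅, ∅, ∅, convex_empty, convex_empty, convex_empty, ?_, ?_, ?_, ?_⟩ <;> simp
      have : Unique V := ⟨⟨0⟩, fun _ => Subsingleton.elim _ _⟩
      simp
    | 1, _, hV =>
      have h1 : HasTriplePartition ℝ 2 := by
        refine ⟨Iio 0, Ioo 0 1, Ioi 1, convex_Iio _, convex_Ioo _ _, convex_Ioi _, ?_, ?_, ?_, ?_⟩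
        · exact disjoint_left.2 fun x h h' => (h.trans h'.1).false
        · exact disjoint_left.2 fun x (h : x < 0) (h' : 1 < x) => by linarith
        · exact disjoint_left.2 fun x h h' => (h.2.trans h').false
        · have : (Iio (0 : ℝ) ∪ Ioo 0 1 ∪ Ioi 1)ᶜ = {0, 1} := by
            ext x
            simp only [mem_compl_iff, mem_union, mem_Iio, mem_Ioo, mem_Ioi, mem_insert_iff,
              mem_singleton_iff]
            grind
          rw [this, encard_pair zero_ne_one]
          rfl
      exact h1.congr (LinearEquiv.ofFinrankEq _ _ (by simp [hV]))
    | d + 2, ih, hV =>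
      have h := (ih d (by lia) (EuclideanSpace ℝ (Fin d)) (by simp)).prod
      have := h.congr (LinearEquiv.ofFinrankEq V _ (by simp [hV]))
      convert this using 1
      lia

/-! ### Punctures of two convex sets -/

/-- `p` lies in no member of the family `K`, but `K` covers a punctured neighbourhood of `p`. -/
def IsPuncture {ι X : Type*} [TopologicalSpace X] (K : ι → Set X) (p : X) : Prop :=
  (∀ i, p ∉ K i) ∧ (⋃ i, K i) ∈ 𝓝[≠] p

theorem tendsto_add_smul_nhdsNE {V : Type*} [NormedAddCommGroup V] [NormedSpace ℝ V] (p : V)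
    {v : V} (hv : v ≠ 0) : Tendsto (fun t : ℝ => p + t • v) (𝓝[≠] 0) (𝓝[≠] p) := by
  have hc : Continuous fun t : ℝ => p + t • v := by fun_prop
  refine tendsto_nhdsWithin_iff.2 ⟨?_, ?_⟩
  · simpa using (hc.tendsto 0).mono_left nhdsWithin_le_nhds
  · filter_upwards [self_mem_nhdsWithin] with t ht
    simpa [hv] using ht

theorem exists_add_smul_mem_sub_smul_mem {V : Type*} [NormedAddCommGroup V] [NormedSpace ℝ V]
    {p v : V} (hv : v ≠ 0) {U : Set V} (hU : U ∈ 𝓝[≠] p) :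
    ∃ t : ℝ, 0 < t ∧ t < 1 ∧ p + t • v ∈ U ∧ p + (-t) • v ∈ U := by
  have h := tendsto_add_smul_nhdsNE p hv hU
  have hn : Tendsto (fun t : ℝ => -t) (𝓝[>] 0) (𝓝[≠] 0) := by
    refine tendsto_nhdsWithin_iff.2 ⟨?_, ?_⟩
    · simpa using (continuous_neg.tendsto (0 : ℝ)).mono_left nhdsWithin_le_nhds
    · filter_upwards [self_mem_nhdsWithin] with t ht
      simpa using (show (0 : ℝ) < t from ht).ne'
  have h1 : ∀ᶠ t : ℝ in 𝓝[>] 0, p + t • v ∈ U :=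
    nhdsWithin_mono _ (fun t ht => (show (0 : ℝ) < t from ht).ne') h
  have h2 : ∀ᶠ t : ℝ in 𝓝[>] 0, p + (-t) • v ∈ U := hn h
  have h3 : ∀ᶠ t : ℝ in 𝓝[>] 0, t ∈ Ioo (0 : ℝ) 1 := Ioo_mem_nhdsGT one_pos
  obtain ⟨t, ht1, ht2, ht3⟩ := (h1.and (h2.and h3)).exists
  exact ⟨t, ht3.1, ht3.2, ht1, ht2⟩

theorem Convex.add_smul_mem_of_mem_Icc {V : Type*} [AddCommGroup V] [Module ℝ V] {A : Set V}
    (hA : Convex ℝ A) {p v : V} {r s c : ℝ} (hr : p + r • v ∈ A) (hs : p + s • v ∈ A)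
    (hrc : r ≤ c) (hcs : c ≤ s) : p + c • v ∈ A := by
  have h : Convex ℝ (AffineMap.lineMap (k := ℝ) p (p + v) ⁻¹' A) := hA.affine_preimage _
  have hm : ∀ t : ℝ, t ∈ AffineMap.lineMap (k := ℝ) p (p + v) ⁻¹' A ↔ p + t • v ∈ A := fun t => by
    simp [AffineMap.lineMap_apply, add_comm]
  exact (hm c).1 (h.ordConnected.out ((hm r).2 hr) ((hm s).2 hs) ⟨hrc, hcs⟩)

section Pair

variable {V : Type*} [NormedAddCommGroup V] [NormedSpace ℝ V] {A B : Set V} {p q : V}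

/-- From a common point `x`, step slightly past `p`: the set covering that point also contains `x`,
hence `p`. -/
theorem disjoint_of_union_mem_nhdsNE (hA : Convex ℝ A) (hB : Convex ℝ B) (hpA : p ∉ A)
    (hpB : p ∉ B) (h : A ∪ B ∈ 𝓝[≠] p) : Disjoint A B := by
  rw [disjoint_left]
  intro x hxA hxB
  have hv : x - p ≠ 0 := sub_ne_zero.2 fun h => hpA (h ▸ hxA)
  obtain ⟨t, ht, -, -, hmem⟩ := exists_add_smul_mem_sub_smul_mem hv h
  have hx : p + (1 : ℝ) • (x - p) = x := by simp
  have hmid : ∀ {A : Set V}, Convex ℝ A → x ∈ A → p + (-t) • (x - p) ∈ A → p ∈ A := by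
    intro A hA hxA hmem
    have := hA.add_smul_mem_of_mem_Icc (c := 0) hmem (by rwa [hx]) (by linarith) zero_le_one
    simpa using this
  rcases hmem with hmem | hmem
  · exact hpA (hmid hA hxA hmem)
  · exact hpB (hmid hB hxB hmem)

/-- On the line from `p` to `q`, the set met just before `p` cannot reappear beyond `p`. The other
set then lies on both sides of `q`, hence contains `q`. -/
theorem eq_of_union_mem_nhdsNE (hA : Convex ℝ A) (hB : Convex ℝ B) (hpA : p ∉ A) (hpB : p ∉ B)
    (hqA : q ∉ A) (hqB : q ∉ B) (hp : A ∪ B ∈ 𝓝[≠] p) (hq : A ∪ B ∈ 𝓝[≠] q) : p = q := by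
  by_contra hpq
  have hv : q - p ≠ 0 := sub_ne_zero.2 (Ne.symm hpq)
  obtain ⟨t, ht, ht1, htp, htm⟩ := exists_add_smul_mem_sub_smul_mem hv hp
  obtain ⟨t', ht', -, htq, -⟩ := exists_add_smul_mem_sub_smul_mem hv hq
  have e : q + t' • (q - p) = p + (1 + t') • (q - p) := by module
  rw [e] at htq
  have zero_mid : ∀ {A : Set V}, Convex ℝ A → p ∉ A → p + (-t) • (q - p) ∈ A →
      ∀ s : ℝ, 0 ≤ s → p + s • (q - p) ∉ A := fun hA hpA h1 s hs h2 =>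
    hpA (by simpa using hA.add_smul_mem_of_mem_Icc (c := 0) h1 h2 (by linarith) hs)
  have one_mid : ∀ {A : Set V}, Convex ℝ A → q ∉ A → p + t • (q - p) ∈ A →
      p + (1 + t') • (q - p) ∉ A := fun hA hqA h1 h2 =>
    hqA (by simpa using hA.add_smul_mem_of_mem_Icc (c := 1) h1 h2 ht1.le (by linarith))
  rcases htm with h | h
  · have h1 := htp.resolve_left (zero_mid hA hpA h t ht.le)
    have h2 := htq.resolve_left (zero_mid hA hpA h (1 + t') (by linarith))
    exact one_mid hB hqB h1 h2
  · have h1 := htp.resolve_right (zero_mid hB hpB h t ht.le)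
    have h2 := htq.resolve_right (zero_mid hB hpB h (1 + t') (by linarith))
    exact one_mid hA hqA h1 h2

end Pair

/-! ### Supporting normals and Gordan's alternative -/

section Separation

variable {E : Type*} [NormedAddCommGroup E] [InnerProductSpace ℝ E]

/-- A small step from `p` along `x` lands in some `K i`, whose normal then cannot be positive on
`x`. -/
theorem exists_inner_le_zero_of_isPuncture {ι : Type*} [Nonempty ι] {K : ι → Set E} {p : E}
    (hp : IsPuncture K p) {u : ι → E} (hu : ∀ i, ∀ x ∈ K i, inner ℝ (u i) x ≤ inner ℝ (u i) p)
    (x : E) : ∃ v ∈ range u, inner ℝ v x ≤ 0 := by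
  rcases eq_or_ne x 0 with rfl | hx
  · exact ⟨_, mem_range_self (Classical.arbitrary ι), by simp⟩
  obtain ⟨t, ht, -, hmem, -⟩ := exists_add_smul_mem_sub_smul_mem hx hp.2
  obtain ⟨i, hi⟩ := mem_iUnion.1 hmem
  refine ⟨u i, mem_range_self i, ?_⟩
  have := hu i _ hi
  rw [inner_add_right, inner_smul_right] at this
  by_contra! h
  have := mul_pos ht h
  linarith

variable [FiniteDimensional ℝ E]

/-- In finite dimension every point outside a convex set is weakly separated from it. -/
theorem exists_normal_of_notMem [Nontrivial E] {A : Set E} (hA : Convex ℝ A) {p : E}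
    (hp : p ∉ A) : ∃ u : E, u ≠ 0 ∧ ∀ x ∈ A, inner ℝ u x ≤ inner ℝ u p := by
  by_cases hint : (interior A).Nonempty
  · obtain ⟨f, hf, h⟩ := geometric_hahn_banach_of_nonempty_interior_point hA
      (fun h => hp (interior_subset h)) hint
    refine ⟨(InnerProductSpace.toDual ℝ E).symm f, by simpa using hf, fun x hx => ?_⟩
    simpa using h x hx
  · rcases A.eq_empty_or_nonempty with rfl | ⟨a, ha⟩
    · obtain ⟨u, hu⟩ := exists_ne (0 : E)
      exact ⟨u, hu, by simp⟩
    -- With empty interior, `A` lies in a proper affine subspace; a vector orthogonal to it is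
    -- constant on `A`, and its sign can be chosen.
    have hne : (affineSpan ℝ A).direction ≠ ⊤ := by
      rwa [Ne, AffineSubspace.direction_eq_top_iff_of_nonempty
        ⟨a, subset_affineSpan ℝ A ha⟩, ← hA.interior_nonempty_iff_affineSpan_eq_top]
    obtain ⟨u, hu, hu0⟩ := (Submodule.ne_bot_iff _).1
      (fun h => hne (Submodule.orthogonal_eq_bot_iff.1 h))
    have hconst : ∀ x ∈ A, inner ℝ u x = inner ℝ u a := by
      intro x hx
      have := Submodule.inner_left_of_mem_orthogonal (AffineSubspace.vsub_mem_direction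
        (subset_affineSpan ℝ A hx) (subset_affineSpan ℝ A ha)) hu
      rw [vsub_eq_sub, inner_sub_right] at this
      linarith
    rcases le_total (inner ℝ u a) (inner ℝ u p) with h | h
    · exact ⟨u, hu0, fun x hx => (hconst x hx).trans_le h⟩
    · refine ⟨-u, neg_ne_zero.2 hu0, fun x hx => ?_⟩
      rw [inner_neg_left, inner_neg_left, hconst x hx]
      linarith

/-- The alternative of Gordan: finitely many vectors without a common positive direction contain the
origin in their convex hull. -/
theorem zero_mem_convexHull_of_forall_exists {s : Set E} (hs : s.Finite)
    (h : ∀ x : E, ∃ u ∈ s, inner ℝ u x ≤ 0) : (0 : E) ∈ convexHull ℝ s := by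
  by_contra h0
  obtain ⟨f, c, hc, hf⟩ := geometric_hahn_banach_point_closed (convex_convexHull ℝ s)
    (hs.isCompact_convexHull ℝ).isClosed h0
  obtain ⟨u, hu, hle⟩ := h ((InnerProductSpace.toDual ℝ E).symm f)
  rw [real_inner_comm, InnerProductSpace.toDual_symm_apply] at hle
  have := hf u (subset_convexHull ℝ s hu)
  rw [map_zero] at hc
  linarith

/-- Two convex sets covering a punctured neighbourhood of a point outside both of them are weakly
separated by a hyperplane through that point. -/
theorem exists_separating_of_union_mem_nhdsNE [Nontrivial E] {A B : Set E} {q : E}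
    (hA : Convex ℝ A) (hB : Convex ℝ B) (hqA : q ∉ A) (hqB : q ∉ B) (h : A ∪ B ∈ 𝓝[≠] q) :
    ∃ v : E, v ≠ 0 ∧ (∀ x ∈ A, inner ℝ v x ≤ inner ℝ v q) ∧
      ∀ x ∈ B, inner ℝ v q ≤ inner ℝ v x := by
  obtain ⟨a, ha0, ha⟩ := exists_normal_of_notMem hA hqA
  obtain ⟨b, hb0, hb⟩ := exists_normal_of_notMem hB hqB
  have hp : IsPuncture (fun c : Bool => cond c A B) q :=
    ⟨by simp [hqA, hqB], by rwa [← union_eq_iUnion]⟩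
  have h0 := zero_mem_convexHull_of_forall_exists (finite_range _)
    (exists_inner_le_zero_of_isPuncture hp (u := fun c => cond c a b) (by simpa using ⟨hb, ha⟩))
  have hr : range (fun c => cond c a b) = {a, b} := by ext; simp [eq_comm, or_comm]
  rw [hr, convexHull_pair] at h0
  obtain ⟨s, t, hs, ht, hst, h0⟩ := h0
  -- Once `s > 0`, `a` is a nonpositive multiple of `b`, which reverses the inequality known on `B`.
  have hs0 : s ≠ 0 := by
    rintro rfl
    obtain rfl : t = 1 := by linarith
    exact hb0 (by simpa using h0)
  refine ⟨a, ha0, ha, fun x hx => ?_⟩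
  have e1 := congrArg (inner ℝ · x) h0
  have e2 := congrArg (inner ℝ · q) h0
  simp only [inner_add_left, inner_smul_left, inner_zero_left, RCLike.conj_to_real] at e1 e2
  have h1 := mul_le_mul_of_nonneg_left (hb x hx) ht
  have hs' : 0 < s := lt_of_le_of_ne hs hs0.symm
  have : s * inner ℝ a q ≤ s * inner ℝ a x := by linarith
  exact le_of_mul_le_mul_left this hs'

end Separation

/-- If the origin is a convex combination of three nonzero vectors, then two of them point in
opposite directions, or the coefficients are positive and the first two vectors are independent. -/
theorem opposite_or_independent_of_zero_mem_convexHull {V : Type*} [AddCommGroup V] [Module ℝ V]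
    {u : Fin 3 → V} (hu : ∀ i, u i ≠ 0) (h : (0 : V) ∈ convexHull ℝ (range u)) :
    (∃ i j, i ≠ j ∧ ∃ t : ℝ, 0 < t ∧ u j = -(t • u i)) ∨
    ((∃ a b c : ℝ, 0 < a ∧ 0 < b ∧ 0 < c ∧ a • u 0 + b • u 1 + c • u 2 = 0) ∧
      LinearIndependent ℝ ![u 0, u 1]) := by
  have opp : ∀ i j : Fin 3, i ≠ j → ∀ a b : ℝ, 0 ≤ a → 0 ≤ b → a + b ≠ 0 →
      a • u i + b • u j = 0 → ∃ i j, i ≠ j ∧ ∃ t : ℝ, 0 < t ∧ u j = -(t • u i) := by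
    intro i j hij a b ha hb hab h
    have ha0 : a ≠ 0 := by
      rintro rfl
      exact hu j (by simpa [show b ≠ 0 by simpa using hab] using h)
    have hb0 : b ≠ 0 := by
      rintro rfl
      exact hu i (by simpa [ha0] using h)
    refine ⟨i, j, hij, b⁻¹ * a, by positivity, ?_⟩
    rw [eq_neg_iff_add_eq_zero, mul_smul]
    simpa [smul_add, smul_smul, hb0, add_comm] using congrArg (b⁻¹ • ·) h
  obtain ⟨a, b, c, ha, hb, hc, habc, h0⟩ : ∃ a b c : ℝ, 0 ≤ a ∧ 0 ≤ b ∧ 0 ≤ c ∧ a + b + c = 1 ∧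
      a • u 0 + b • u 1 + c • u 2 = 0 := by
    have hr : range u = {u 0, u 1, u 2} := by
      ext x
      simp [Fin.exists_fin_succ, eq_comm]
    rw [hr, convexHull_insert (by simp), convexHull_pair, mem_convexJoin] at h
    obtain ⟨_, rfl, _, ⟨s, t, hs, ht, hst, rfl⟩, a, b, ha, hb, hab, h⟩ := h
    refine ⟨a, b * s, b * t, ha, by positivity, by positivity, ?_, ?_⟩
    · rw [add_assoc, ← mul_add, hst, mul_one, hab]
    · rw [← h]
      module
  rcases ha.eq_or_lt with rfl | ha
  · exact Or.inl (opp 1 2 (by decide) b c hb hc (by linarith) (by simpa using h0))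
  rcases hb.eq_or_lt with rfl | hb
  · exact Or.inl (opp 0 2 (by decide) a c ha.le hc (by linarith) (by simpa using h0))
  rcases hc.eq_or_lt with rfl | hc
  · exact Or.inl (opp 0 1 (by decide) a b ha.le hb.le (by linarith) (by simpa using h0))
  by_cases hli : LinearIndependent ℝ ![u 0, u 1]
  · exact Or.inr ⟨⟨a, b, c, ha, hb, hc, h0⟩, hli⟩
  left
  rw [LinearIndependent.pair_iff' (hu 0)] at hli
  push Not at hli
  obtain ⟨t, ht⟩ := hli
  -- Here `u 1 = t • u 0`: either these two are opposite, or they merge into one positive multiple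
  -- of `u 0` opposite to `u 2`.
  rcases le_or_gt t 0 with ht0 | ht0
  · exact opp 0 1 (by decide) (-t) 1 (by linarith) zero_le_one (by linarith)
      (by rw [← ht]; module)
  · refine opp 0 2 (by decide) (a + b * t) c (by positivity) hc.le (by positivity) ?_
    rw [← h0, ← ht]
    module

/-! ### The upper bound by induction on dimension -/

section Upper

variable {E : Type*} [NormedAddCommGroup E]

/-- The punctures of `K` near which `K k` is absent. -/
def punctureAvoiding (K : Fin 3 → Set E) (k : Fin 3) : Set E :=
  {q | IsPuncture K q ∧ (K k)ᶜ ∈ 𝓝 q}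

variable {K : Fin 3 → Set E}

theorem union_mem_nhdsNE_of_mem_punctureAvoiding {i j k : Fin 3} (hij : i ≠ j) (hik : i ≠ k)
    (hjk : j ≠ k) {q : E} (hq : q ∈ punctureAvoiding K k) : K i ∪ K j ∈ 𝓝[≠] q := by
  filter_upwards [hq.1.2, mem_nhdsWithin_of_mem_nhds hq.2] with x hx hxk
  obtain ⟨l, hl⟩ := mem_iUnion.1 hx
  have : l = i ∨ l = j ∨ l = k := by lia
  rcases this with rfl | rfl | rfl
  · exact Or.inl hl
  · exact Or.inr hl
  · exact absurd hl hxk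

variable [InnerProductSpace ℝ E]

theorem subsingleton_punctureAvoiding (hK : ∀ i, Convex ℝ (K i)) (k : Fin 3) :
    (punctureAvoiding K k).Subsingleton := by
  obtain ⟨i, j, hij, hik, hjk⟩ : ∃ i j, i ≠ j ∧ i ≠ k ∧ j ≠ k := by decide +revert
  exact fun p hp q hq => eq_of_union_mem_nhdsNE (hK i) (hK j) (hp.1.1 i) (hp.1.1 j) (hq.1.1 i)
    (hq.1.1 j) (union_mem_nhdsNE_of_mem_punctureAvoiding hij hik hjk hp)
    (union_mem_nhdsNE_of_mem_punctureAvoiding hij hik hjk hq)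

theorem disjoint_of_punctureAvoiding_nonempty (hK : ∀ i, Convex ℝ (K i)) {i j k : Fin 3}
    (hij : i ≠ j) (hik : i ≠ k) (hjk : j ≠ k) (h : (punctureAvoiding K k).Nonempty) :
    Disjoint (K i) (K j) := by
  obtain ⟨q, hq⟩ := h
  exact disjoint_of_union_mem_nhdsNE (hK i) (hK j) (hq.1.1 i) (hq.1.1 j)
    (union_mem_nhdsNE_of_mem_punctureAvoiding hij hik hjk hq)

theorem mem_punctureAvoiding_of_lt {k : Fin 3} {u : E} {c : ℝ} (h : ∀ x ∈ K k, inner ℝ u x ≤ c)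
    {q : E} (hq : IsPuncture K q) (hc : c < inner ℝ u q) : q ∈ punctureAvoiding K k := by
  refine ⟨hq, ?_⟩
  have ho : IsOpen {x : E | c < inner ℝ u x} := isOpen_lt continuous_const (by fun_prop)
  filter_upwards [ho.mem_nhds hc] with x hx hxk
  exact (h x hxk).not_gt hx

theorem mem_punctureAvoiding_of_gt {k : Fin 3} {u : E} {c : ℝ} (h : ∀ x ∈ K k, c ≤ inner ℝ u x)
    {q : E} (hq : IsPuncture K q) (hc : inner ℝ u q < c) : q ∈ punctureAvoiding K k :=
  mem_punctureAvoiding_of_lt (u := -u) (c := -c)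
    (fun x hx => by simpa [inner_neg_left] using h x hx) hq (by simpa [inner_neg_left] using hc)

/-- The bound on the number of punctures, together with its equality case. -/
def PunctureBound (K : Fin 3 → Set E) (n : ℕ) : Prop :=
  {p | IsPuncture K p}.encard ≤ n ∧
    ({p | IsPuncture K p}.encard = n → ∀ i j, i ≠ j → Disjoint (K i) (K j))

/-- Every triple of convex sets in a space of dimension `d` satisfies the puncture bound. -/
def PunctureBoundInDim.{w} (d : ℕ) : Prop :=
  ∀ (F : Type w) [NormedAddCommGroup F] [InnerProductSpace ℝ F] [FiniteDimensional ℝ F],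
    Module.finrank ℝ F = d → ∀ K : Fin 3 → Set F, (∀ i, Convex ℝ (K i)) →
      PunctureBound K (3 * d / 2 + 1)

theorem encard_punctures_inter_le {F : Type*} [NormedAddCommGroup F] [InnerProductSpace ℝ F]
    (K : Fin 3 → Set F) (W : Submodule ℝ F) (p : F) :
    ({q | IsPuncture K q} ∩ {q | q - p ∈ W}).encard ≤
      {w : W | IsPuncture (fun i => {w : W | p + w ∈ K i}) w}.encard := by
  refine le_trans (encard_le_encard ?_) (encard_image_le (fun w : W => p + (w : F)) _)
  rintro q ⟨hq, hqW⟩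
  have e : p + (q - p) = q := by abel
  refine ⟨⟨q - p, hqW⟩, ⟨fun i hi => hq.1 i ?_, ?_⟩, e⟩
  · simpa using hi
  · have ht : Tendsto (fun w : W => p + (w : F)) (𝓝[≠] ⟨q - p, hqW⟩) (𝓝[≠] q) := by
      have hc : Continuous fun w : W => p + (w : F) := by fun_prop
      refine tendsto_nhdsWithin_iff.2 ⟨?_, ?_⟩
      · have := (hc.tendsto ⟨q - p, hqW⟩).mono_left (nhdsWithin_le_nhds (s := {⟨q - p, hqW⟩}ᶜ))
        simpa using this
      · filter_upwards [self_mem_nhdsWithin] with w hw h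
        refine hw (Subtype.ext ?_)
        exact eq_sub_of_add_eq' h
    filter_upwards [ht hq.2] with w hw
    simpa using hw

/-- A nonempty level set is a translate of the `m`-dimensional orthogonal complement of the span of
`v`, and punctures on it remain punctures of the sliced sets. -/
theorem encard_punctures_inter_level_le.{w} {F : Type w} [NormedAddCommGroup F]
    [InnerProductSpace ℝ F] [FiniteDimensional ℝ F] {K : Fin 3 → Set F}
    (hK : ∀ i, Convex ℝ (K i)) {n m : ℕ} (ih : PunctureBoundInDim.{w} m) {v : Fin n → F}
    (hv : LinearIndependent ℝ v) (hm : Module.finrank ℝ F = m + n) (c : Fin n → ℝ) :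
    ({q | IsPuncture K q} ∩ {q | ∀ i, inner ℝ (v i) q = c i}).encard ≤ (3 * m / 2 + 1 : ℕ) := by
  rcases ({q | IsPuncture K q} ∩ {q | ∀ i, inner ℝ (v i) q = c i}).eq_empty_or_nonempty with
    h | ⟨p, -, hp⟩
  · simp [h]
  let W := (Submodule.span ℝ (range v))ᗮ
  have hW : Module.finrank ℝ W = m := by
    have h1 := Submodule.finrank_add_finrank_orthogonal (Submodule.span ℝ (range v))
    rw [finrank_span_eq_card hv, Fintype.card_fin] at h1
    change n + Module.finrank ℝ W = _ at h1
    lia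
  have hcv : ∀ i, Convex ℝ {w : W | p + w ∈ K i} := fun i =>
    ((hK i).translate_preimage_right p).linear_preimage W.subtype
  refine le_trans (encard_le_encard ?_)
    ((encard_punctures_inter_le K W p).trans (ih W hW _ hcv).1)
  rintro q ⟨hq, hqc⟩
  refine ⟨hq, (Submodule.mem_orthogonal _ _).2 fun x hx => ?_⟩
  induction hx using Submodule.span_induction with
  | mem x hx =>
    obtain ⟨i, rfl⟩ := hx
    rw [inner_sub_right, hqc i, hp i, sub_self]
  | zero => simp
  | add x y _ _ hx hy => rw [inner_add_left, hx, hy, add_zero]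
  | smul a x _ hx => rw [inner_smul_left, hx, mul_zero]

/-- Since f(d - 1) < f(d), the equality case cannot occur. -/
theorem punctureBound_of_subset_hyperplane.{w} {F : Type w} [NormedAddCommGroup F]
    [InnerProductSpace ℝ F] [FiniteDimensional ℝ F] {K : Fin 3 → Set F}
    (hK : ∀ i, Convex ℝ (K i)) {d : ℕ} (ih : ∀ m < d, PunctureBoundInDim.{w} m)
    (hd : Module.finrank ℝ F = d) {u : F} (hu : u ≠ 0) {c : ℝ}
    (h : ∀ q, IsPuncture K q → inner ℝ u q = c) : PunctureBound K (3 * d / 2 + 1) := by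
  have : Nontrivial F := ⟨u, 0, hu⟩
  obtain ⟨m, rfl⟩ : ∃ m, d = m + 1 := Nat.exists_eq_succ_of_ne_zero
    (hd ▸ Module.finrank_pos (R := ℝ) (M := F)).ne'
  have hle := encard_punctures_inter_level_le hK (ih m (by lia)) (v := fun _ : Fin 1 => u)
    (linearIndependent_unique_iff.2 hu) hd (fun _ => c)
  have hsub : {q | IsPuncture K q} ⊆
      {q | IsPuncture K q} ∩ {q | ∀ _ : Fin 1, inner ℝ u q = c} := fun q hq => ⟨hq, fun _ => h q hq⟩
  replace hle := (encard_le_encard hsub).trans hle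
  have hlt : ((3 * m / 2 + 1 : ℕ) : ℕ∞) < (3 * (m + 1) / 2 + 1 : ℕ) := by
    exact_mod_cast (by lia)
  exact ⟨hle.trans hlt.le, fun he => absurd (he ▸ hle) hlt.not_ge⟩

/-- The count is f(d - 2) + 1 + 1 + 1 = f(d). Equality requires all three exceptional punctures,
each making the other two sets disjoint. -/
theorem punctureBound_of_subset_codim_two.{w} {F : Type w} [NormedAddCommGroup F]
    [InnerProductSpace ℝ F] [FiniteDimensional ℝ F] {K : Fin 3 → Set F}
    (hK : ∀ i, Convex ℝ (K i)) {d : ℕ} (ih : ∀ m < d, PunctureBoundInDim.{w} m)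
    (hd : Module.finrank ℝ F = d) {u v : F} (huv : LinearIndependent ℝ ![u, v]) {a b : ℝ}
    (h : ∀ q, IsPuncture K q →
      (inner ℝ u q = a ∧ inner ℝ v q = b) ∨ ∃ k, q ∈ punctureAvoiding K k) :
    PunctureBound K (3 * d / 2 + 1) := by
  obtain ⟨m, rfl⟩ : ∃ m, d = m + 2 := by
    have := huv.fintype_card_le_finrank
    rw [hd, Fintype.card_fin] at this
    exact ⟨d - 2, by lia⟩
  have hle := encard_punctures_inter_level_le hK (ih m (by lia)) huv hd ![a, b]
  have hs : {q | IsPuncture K q} ⊆ ({q | IsPuncture K q} ∩ {q | ∀ i, inner ℝ (![u, v] i) q =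
      ![a, b] i}) ∪ (punctureAvoiding K 0 ∪ (punctureAvoiding K 1 ∪ punctureAvoiding K 2)) := by
    intro q hq
    rcases h q hq with h | ⟨k, hk⟩
    · exact Or.inl ⟨hq, by simpa [Fin.forall_fin_two] using h⟩
    · right
      fin_cases k
      · exact Or.inl hk
      · exact Or.inr (Or.inl hk)
      · exact Or.inr (Or.inr hk)
  have h1 : ∀ k, (punctureAvoiding K k).encard ≤ 1 := fun k =>
    encard_le_one_iff_subsingleton.2 (subsingleton_punctureAvoiding hK k)
  have hcard := (encard_le_encard hs).trans ((encard_union_le _ _).trans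
    (add_le_add hle ((encard_union_le _ _).trans (add_le_add_right (encard_union_le _ _) _))))
  have hne : ∀ k, (punctureAvoiding K k).encard = 0 ∨ (punctureAvoiding K k).Nonempty := fun k => by
    rw [encard_eq_zero]
    exact (punctureAvoiding K k).eq_empty_or_nonempty
  have h10 := h1 0
  have h11 := h1 1
  have h12 := h1 2
  have hn0 := hne 0
  have hn1 := hne 1
  have hn2 := hne 2
  have lift_le : ∀ {x : ℕ∞}, x ≤ 1 → ∃ y : ℕ, x = y := fun hx =>
    ENat.ne_top_iff_exists.1 (ne_top_of_le_ne_top ENat.one_ne_top hx) |>.imp fun _ => Eq.symm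
  obtain ⟨x0, e0⟩ := lift_le h10
  obtain ⟨x1, e1⟩ := lift_le h11
  obtain ⟨x2, e2⟩ := lift_le h12
  rw [e0, e1, e2] at hcard
  rw [e0] at h10 hn0
  rw [e1] at h11 hn1
  rw [e2] at h12 hn2
  norm_cast at hcard h10 h11 h12 hn0 hn1 hn2
  refine ⟨hcard.trans (by exact_mod_cast (by lia)), fun he i j hij => ?_⟩
  rw [he] at hcard
  norm_cast at hcard
  have hall : ∀ k, (punctureAvoiding K k).Nonempty := by
    intro k
    fin_cases k
    · exact hn0.resolve_left (by lia)
    · exact hn1.resolve_left (by lia)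
    · exact hn2.resolve_left (by lia)
  obtain ⟨k, hik, hjk⟩ : ∃ k, i ≠ k ∧ j ≠ k :=
    (by decide : ∀ i j : Fin 3, ∃ k, i ≠ k ∧ j ≠ k) i j
  exact disjoint_of_punctureAvoiding_nonempty hK hij hik hjk (hall k)

theorem punctureBound_of_subset_union (hK : ∀ i, Convex ℝ (K i)) {i j k : Fin 3} (hij : i ≠ j)
    (hik : i ≠ k) (hjk : j ≠ k) {n : ℕ} (hn : 2 ≤ n) (hd : Disjoint (K i) (K j))
    (h : ∀ q, IsPuncture K q → q ∈ punctureAvoiding K i ∨ q ∈ punctureAvoiding K j) :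
    PunctureBound K n := by
  have hs : {q | IsPuncture K q} ⊆ punctureAvoiding K i ∪ punctureAvoiding K j := h
  have h1 : ∀ k, (punctureAvoiding K k).encard ≤ 1 := fun k =>
    encard_le_one_iff_subsingleton.2 (subsingleton_punctureAvoiding hK k)
  have h2 : ((2 : ℕ) : ℕ∞) ≤ n := by exact_mod_cast hn
  have hle := (encard_le_encard hs).trans (encard_union_le _ _)
  refine ⟨hle.trans ((add_le_add (h1 i) (h1 j)).trans (le_trans (by norm_num) h2)), fun he => ?_⟩
  rw [he] at hle
  replace hle := h2.trans hle
  have hi : (punctureAvoiding K i).Nonempty := by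
    by_contra hne
    rw [not_nonempty_iff_eq_empty.1 hne, encard_empty, zero_add] at hle
    have := hle.trans (h1 j)
    norm_cast at this
  have hj : (punctureAvoiding K j).Nonempty := by
    by_contra hne
    rw [not_nonempty_iff_eq_empty.1 hne, encard_empty, add_zero] at hle
    have := hle.trans (h1 i)
    norm_cast at this
  have djk := disjoint_of_punctureAvoiding_nonempty hK hjk hij.symm hik.symm hi
  have dik := disjoint_of_punctureAvoiding_nonempty hK hik hij hjk.symm hj
  intro a b hab
  have ha : a = i ∨ a = j ∨ a = k := by lia
  have hb : b = i ∨ b = j ∨ b = k := by lia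
  rcases ha with rfl | rfl | rfl <;> rcases hb with rfl | rfl | rfl <;>
    first
      | exact absurd rfl hab
      | exact hd
      | exact hd.symm
      | exact djk
      | exact djk.symm
      | exact dik
      | exact dik.symm

theorem disjoint_of_inner_lt {A B : Set E} {u : E} {a b : ℝ} (hA : ∀ x ∈ A, inner ℝ u x ≤ a)
    (hB : ∀ x ∈ B, b ≤ inner ℝ u x) (hab : a < b) : Disjoint A B :=
  disjoint_left.2 fun x hxA hxB => ((hA x hxA).trans_lt (hab.trans_le (hB x hxB))).false

/-- `K j` is absent near `q`, so a hyperplane through `q` separates `K i` from `K k`. If it is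
transverse to the first, punctures are exceptional or on the intersection; if parallel, at most two
remain. -/
theorem punctureBound_of_separated_of_lt.{w} {F : Type w} [NormedAddCommGroup F]
    [InnerProductSpace ℝ F] [FiniteDimensional ℝ F] {K : Fin 3 → Set F}
    (hK : ∀ i, Convex ℝ (K i)) {d : ℕ} (ih : ∀ m < d, PunctureBoundInDim.{w} m)
    (hd : Module.finrank ℝ F = d) {i j k : Fin 3} (hij : i ≠ j) (hik : i ≠ k) (hjk : j ≠ k) {u : F}
    (hu : u ≠ 0) {a : ℝ} (hi : ∀ x ∈ K i, inner ℝ u x ≤ a) (hj : ∀ x ∈ K j, a ≤ inner ℝ u x)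
    {q : F} (hq : IsPuncture K q) (hqa : inner ℝ u q < a) : PunctureBound K (3 * d / 2 + 1) := by
  have : Nontrivial F := ⟨u, 0, hu⟩
  have hd1 : 0 < d := hd ▸ Module.finrank_pos (R := ℝ) (M := F)
  have hqj := mem_punctureAvoiding_of_gt hj hq hqa
  obtain ⟨v, hv, hvi, hvk⟩ := exists_separating_of_union_mem_nhdsNE (hK i) (hK k) (hq.1 i) (hq.1 k)
    (union_mem_nhdsNE_of_mem_punctureAvoiding hik hij hjk.symm hqj)
  by_cases hli : LinearIndependent ℝ ![u, v]
  · refine punctureBound_of_subset_codim_two hK ih hd hli (a := a) (b := inner ℝ v q)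
      fun x hx => ?_
    rcases lt_trichotomy (inner ℝ u x) a with h1 | h1 | h1
    · exact Or.inr ⟨j, mem_punctureAvoiding_of_gt hj hx h1⟩
    · rcases lt_trichotomy (inner ℝ v x) (inner ℝ v q) with h2 | h2 | h2
      · exact Or.inr ⟨k, mem_punctureAvoiding_of_gt hvk hx h2⟩
      · exact Or.inl ⟨h1, h2⟩
      · exact Or.inr ⟨i, mem_punctureAvoiding_of_lt hvi hx h2⟩
    · exact Or.inr ⟨i, mem_punctureAvoiding_of_lt hi hx h1⟩
  · rw [LinearIndependent.pair_iff' hu] at hli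
    push Not at hli
    obtain ⟨s, rfl⟩ := hli
    simp only [inner_smul_left, RCLike.conj_to_real] at hvi hvk
    rcases lt_trichotomy s 0 with hs | rfl | hs
    · replace hvk : ∀ x ∈ K k, inner ℝ u x ≤ inner ℝ u q := fun x hx =>
        (mul_le_mul_left_of_neg hs).1 (hvk x hx)
      refine punctureBound_of_subset_union hK hjk hij.symm hik.symm (by lia)
        (disjoint_of_inner_lt hvk hj hqa).symm fun x hx => ?_
      rcases lt_or_ge (inner ℝ u x) a with h1 | h1
      · exact Or.inl (mem_punctureAvoiding_of_gt hj hx h1)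
      · exact Or.inr (mem_punctureAvoiding_of_lt hvk hx (hqa.trans_le h1))
    · simp at hv
    · replace hvi : ∀ x ∈ K i, inner ℝ u x ≤ inner ℝ u q := fun x hx =>
        (mul_le_mul_iff_right₀ hs).1 (hvi x hx)
      refine punctureBound_of_subset_union hK hij hik hjk (by lia)
        (disjoint_of_inner_lt hvi hj hqa) fun x hx => ?_
      rcases lt_or_ge (inner ℝ u x) a with h1 | h1
      · exact Or.inr (mem_punctureAvoiding_of_gt hj hx h1)
      · exact Or.inl (mem_punctureAvoiding_of_lt hvi hx (hqa.trans_le h1))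

theorem punctureBound_of_separated.{w} {F : Type w} [NormedAddCommGroup F]
    [InnerProductSpace ℝ F] [FiniteDimensional ℝ F] {K : Fin 3 → Set F}
    (hK : ∀ i, Convex ℝ (K i)) {d : ℕ} (ih : ∀ m < d, PunctureBoundInDim.{w} m)
    (hd : Module.finrank ℝ F = d) {i j : Fin 3} (hij : i ≠ j) {u : F}
    (hu : u ≠ 0) {a : ℝ} (hi : ∀ x ∈ K i, inner ℝ u x ≤ a) (hj : ∀ x ∈ K j, a ≤ inner ℝ u x) :
    PunctureBound K (3 * d / 2 + 1) := by
  obtain ⟨k, hik, hjk⟩ : ∃ k, i ≠ k ∧ j ≠ k :=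
    (by decide : ∀ i j : Fin 3, ∃ k, i ≠ k ∧ j ≠ k) i j
  by_cases h : ∀ q, IsPuncture K q → inner ℝ u q = a
  · exact punctureBound_of_subset_hyperplane hK ih hd hu h
  push Not at h
  obtain ⟨q, hq, hqa⟩ := h
  rcases hqa.lt_or_gt with hlt | hgt
  · exact punctureBound_of_separated_of_lt hK ih hd hij hik hjk hu hi hj hq hlt
  · exact punctureBound_of_separated_of_lt hK ih hd hij.symm hjk hik (neg_ne_zero.2 hu) (a := -a)
      (by simpa [inner_neg_left] using hj) (by simpa [inner_neg_left] using hi) hq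
      (by simpa [inner_neg_left] using hgt)

theorem punctureBoundInDim.{w} (d : ℕ) : PunctureBoundInDim.{w} d := by
  induction d using Nat.strong_induction_on with
  | _ d ih =>
    intro F _ _ _ hd K hK
    rcases {p | IsPuncture K p}.eq_empty_or_nonempty with h | ⟨p, hp⟩
    · refine ⟨by simp [h], fun he => ?_⟩
      rw [h, encard_empty] at he
      norm_cast at he
    rcases subsingleton_or_nontrivial F with hF | hF
    · refine ⟨(encard_le_one_iff_subsingleton.2 subsingleton_of_subsingleton).trans
        (by exact_mod_cast (by lia)), fun _ i j _ => disjoint_left.2 fun x hx => ?_⟩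
      exact absurd (Subsingleton.elim x p ▸ hx) (hp.1 i)
    choose u hu0 hu using fun i => exists_normal_of_notMem (hK i) (hp.1 i)
    rcases opposite_or_independent_of_zero_mem_convexHull hu0
      (zero_mem_convexHull_of_forall_exists (finite_range u)
        (exists_inner_le_zero_of_isPuncture hp hu)) with
      ⟨i, j, hij, t, ht, hji⟩ | ⟨⟨a, b, c, ha, hb, hc, h0⟩, hli⟩
    · refine punctureBound_of_separated hK ih hd hij (hu0 i) (hu i) fun x hx => ?_
      have := hu j x hx
      rw [hji, inner_neg_left, inner_neg_left, neg_le_neg_iff, inner_smul_left,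
        inner_smul_left] at this
      exact le_of_mul_le_mul_left this ht
    · refine punctureBound_of_subset_codim_two hK ih hd hli (a := inner ℝ (u 0) p)
        (b := inner ℝ (u 1) p) fun q hq => ?_
      by_cases hex : ∃ k, inner ℝ (u k) p < inner ℝ (u k) q
      · obtain ⟨k, hk⟩ := hex
        exact Or.inr ⟨k, mem_punctureAvoiding_of_lt (hu k) hq hk⟩
      push Not at hex
      -- A vanishing sum of nonnegative terms: each is zero, so `q` lies on all three supporting
      -- hyperplanes.
      have e := congrArg (inner ℝ · (p - q)) h0
      simp only [inner_add_left, inner_smul_left, inner_zero_left, RCLike.conj_to_real,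
        inner_sub_right] at e
      have p0 := mul_nonneg ha.le (sub_nonneg.2 (hex 0))
      have p1 := mul_nonneg hb.le (sub_nonneg.2 (hex 1))
      have p2 := mul_nonneg hc.le (sub_nonneg.2 (hex 2))
      have z0 := (mul_eq_zero.1 (show a * (inner ℝ (u 0) p - inner ℝ (u 0) q) = 0 by
        linarith)).resolve_left ha.ne'
      have z1 := (mul_eq_zero.1 (show b * (inner ℝ (u 1) p - inner ℝ (u 1) q) = 0 by
        linarith)).resolve_left hb.ne'
      exact Or.inl ⟨by linarith, by linarith⟩

end Upper

/-! ### Back to encapsulated points -/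

theorem isEncapsulated_iff_isPuncture {d : ℕ} {ι : Type*} (K : ι → Set (EuclideanSpace ℝ (Fin d)))
    (p : EuclideanSpace ℝ (Fin d)) : IsEncapsulated K p ↔ IsPuncture K p := by
  constructor
  · rintro ⟨ε, hε, h⟩
    refine ⟨fun i hi => (h.ge rfl).2 (mem_iUnion_of_mem i hi), ?_⟩
    rw [mem_nhdsWithin_iff_exists_mem_nhds_inter]
    refine ⟨_, Metric.ball_mem_nhds p hε, fun x hx => ?_⟩
    by_contra hxK
    exact hx.2 (h.le ⟨hx.1, hxK⟩)
  · rintro ⟨hp, h⟩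
    obtain ⟨ε, hε, hsub⟩ := Metric.mem_nhdsWithin_iff.1 h
    refine ⟨ε, hε, Subset.antisymm (fun x hx => ?_) ?_⟩
    · by_contra hxp
      exact hx.2 (hsub ⟨hx.1, hxp⟩)
    · rintro _ rfl
      exact ⟨Metric.mem_ball_self hε, by simpa using hp⟩

/-- A finite uncovered set is discrete, so each of its points is isolated in it. -/
theorem encapsulatedPoints_eq_compl {d : ℕ} {ι : Type*} {K : ι → Set (EuclideanSpace ℝ (Fin d))}
    (h : (⋃ i, K i)ᶜ.Finite) : encapsulatedPoints K = (⋃ i, K i)ᶜ := by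
  ext p
  change IsEncapsulated K p ↔ _
  rw [isEncapsulated_iff_isPuncture]
  refine ⟨fun hp => by simpa using hp.1, fun hp => ⟨by simpa using hp, ?_⟩⟩
  rw [mem_nhdsWithin_iff_exists_mem_nhds_inter]
  refine ⟨((⋃ i, K i)ᶜ \ {p})ᶜ, (h.sdiff.isClosed.isOpen_compl).mem_nhds (by simp), ?_⟩
  rintro x ⟨hx, hxp⟩
  by_contra hxK
  exact hx ⟨hxK, hxp⟩

theorem theorem1 (d : ℕ) :
    (∀ K : Fin 3 → Set (EuclideanSpace ℝ (Fin d)), (∀ i, Convex ℝ (K i)) →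
      (encapsulatedPoints K).encard ≤ ((3 * d / 2 + 1 : ℕ) : ℕ∞) ∧
      ((encapsulatedPoints K).encard = ((3 * d / 2 + 1 : ℕ) : ℕ∞) →
        ∀ i j, i ≠ j → Disjoint (K i) (K j))) ∧
    (∃ K : Fin 3 → Set (EuclideanSpace ℝ (Fin d)), (∀ i, Convex ℝ (K i)) ∧
      (encapsulatedPoints K).encard = ((3 * d / 2 + 1 : ℕ) : ℕ∞) ∧
      (⋃ i, K i)ᶜ = encapsulatedPoints K) := by
  refine ⟨fun K hK => ?_, ?_⟩
  · have h : encapsulatedPoints K = {p | IsPuncture K p} :=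
      Set.ext fun p => isEncapsulated_iff_isPuncture K p
    rw [h]
    exact punctureBoundInDim d _ (by simp) K hK
  · obtain ⟨A, B, C, hA, hB, hC, -, -, -, hn⟩ :=
      hasTriplePartition_of_finrank d (EuclideanSpace ℝ (Fin d)) (by simp)
    have hU : (⋃ i, ![A, B, C] i) = A ∪ B ∪ C := by
      ext x
      simp [Fin.exists_fin_succ, or_assoc]
    have he := encapsulatedPoints_eq_compl (K := ![A, B, C])
      (finite_of_encard_eq_coe (by rw [hU, hn]))
    refine ⟨![A, B, C], ?_, by rw [he, hU, hn], he.symm⟩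
    intro i
    fin_cases i
    · exact hA
    · exact hB
    · exact hC
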